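/- Let $n\ge 0$, let $\mathbb{Q}(X)=\mathbb{Q}(x_1,\dots,x_n)$, and let $W_n=\mathbb{Q}(X)[\partial_1,\dots,\partial_n]$ be the rational Weyl algebra, that is, the $\mathbb{Q}$-algebra of polynomials in $\partial_1,\dots,\partial_n$ with coefficients in $\mathbb{Q}(X)$ written on the left, with the commutation laws $\partial_i\partial_j=\partial_j\partial_i$ and $\partial_i f=f\partial_i+\frac{d f}{dx_i}$ for $f\in\mathbb{Q}(X)$. It is a $\mathbb{Q}(X)$-vector space with basis the set $\mathrm{Mon}=\{\partial^\alpha:\alpha\in\mathbb{N}^n\}$ of monomials; supports are taken with respect to this basis. Let $\prec$ be a monomial order on $\mathrm{Mon}$ (a well-founded total order such that $\partial^\alpha\prec\partial^\beta$ implies $\partial^{\alpha+\gamma}\prec\partial^{\beta+\gamma}$). For $0\neq D\in W_n$ let $\mathrm{lm}(D)$ be the greatest element of the support of $D$; $D$ is monic if $\mathrm{lm}(D)$ has coefficient $1$ in $D$, and then $r(D)=\mathrm{lm}(D)-D$. Let $\Theta\subset W_n$ be a finite set of monic operators with pairwise distinct leading monomials, and let $\mathrm{lm}(\Theta)=\{\mathrm{lm}(D):D\in\Theta\}$.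 Let $R_\Theta$ be the set of rules $\partial^\alpha\mathrm{lm}(D)\to\partial^\alpha r(D)$ with $D\in\Theta$ and $\alpha\in\mathbb{N}^n$. The rewriting relation $\to_\Theta$ on $W_n$ consists of the steps $\lambda e+u\to_\Theta\lambda v+u$, where $e\to v$ is a rule in $R_\Theta$, $0\ne\lambda\in\mathbb{Q}(X)$, and $u\in W_n$ has $e\notin\mathrm{supp}(u)$. An involutive division $L$ on $\mathrm{Mon}$ consists of a relation $\mid_L^U$ on $U\times\mathrm{Mon}$ for every finite $U\subset\mathrm{Mon}$ such that, for all $u,u'\in U$ and $m,m'\in\mathrm{Mon}$: (a) $u\mid_L^U m$ implies $u\mid m$; (b) $u\mid_L^U u$; (c) $u\mid_L^U um$ and $u\mid_L^U um'$ if and only if $u\mid_L^U umm'$; (d) $u\mid_L^U m$ and $u'\mid_L^U m$ imply $u\mid_L^U u'$ or $u'\mid_L^U u$; (e) $u\mid_L^U u'$ and $u'\mid_L^U m$ imply $u\mid_L^U m$; (f) for $V\subseteq U$ and $v\in V$, $v\mid_L^U m$ implies $v\mid_L^V m$. Let $L$ be an involutive division such that $\Theta$ is left $L$-autoreduced: for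 all $u,u'\in\mathrm{lm}(\Theta)$, $u'\mid_L^{\mathrm{lm}(\Theta)}u$ implies $u'=u$. Let $S_{\Theta,L}\subseteq R_\Theta$ be the set of the rules $\partial^\alpha\mathrm{lm}(D)\to\partial^\alpha r(D)$ with $D\in\Theta$ and $\mathrm{lm}(D)\mid_L^{\mathrm{lm}(\Theta)}\partial^\alpha\mathrm{lm}(D)$; their left-hand sides are pairwise distinct. Let $r_S$ be the $\mathbb{Q}(X)$-linear endomorphism of $W_n$ that maps a monomial $e$ to $v$ if $e\to v$ is a rule in $S_{\Theta,L}$, and to $e$ if no rule in $S_{\Theta,L}$ has left-hand side $e$. The $S_{\Theta,L}$-normal form of $w\in W_n$ is the element $w'=r_S^k(w)$, for some $k\ge 0$, with $r_S(w')=w'$. If $\Theta$ is $L$-involutive, that is, if the $S_{\Theta,L}$-normal form of $\partial^\alpha D$ is $0$ for all $D\in\Theta$ and all $\alpha\in\mathbb{N}^n$, then $\to_\Theta$ is confluent: whenever $w$ rewrites by finitely many (possibly zero) steps of $\to_\Theta$ into $w_1$ and into $w_2$, then $w_1$ and $w_2$ both rewrite by finitely many steps of $\to_\Theta$ into a common element.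 -/

import Mathlib

noncomputable section

namespace InvRew

/-! ## Rewriting in a vector space with a fixed basis

`V` is a vector space over a field `K` with basis `b`, and a set of rewriting rules `e → v`
(`e` a basis element, `v` a vector) is a set `R` of pairs `(e, v)`, a basis element being
given by its index. -/

section Rewriting

variable {K V ι : Type*} [Field K] [AddCommGroup V] [Module K V]

/-- One rewriting step `λ e + u → λ v + u`, where `e → v` is a rule, `λ ≠ 0`, and `e` is not in
the support of `u`. -/
def Step (b : Module.Basis ι K V) (R : Set (ι × V)) (w w' : V) : Prop :=
  ∃ ρ ∈ R, ∃ c : K, c ≠ 0 ∧ ∃ u : V, ρ.1 ∉ (b.repr u).support ∧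
    w = c • b ρ.1 + u ∧ w' = c • ρ.2 + u

/-- Confluence of a binary relation: if `x` rewrites into `y` and into `z`, then `y` and `z`
rewrite into a common element. -/
def Confluent {A : Type*} (r : A → A → Prop) : Prop :=
  ∀ x y z : A, Relation.ReflTransGen r x y → Relation.ReflTransGen r x z →
    ∃ t, Relation.ReflTransGen r y t ∧ Relation.ReflTransGen r z t

open Classical in
/-- The endomorphism `r_S` of `V` attached to a set `S` of rules with pairwise distinct left-hand
sides: `r_S e = v` if `e → v` is in `S`, and `r_S e = e` if no rule of `S` has left-hand
side `e`. -/
def parMap (b : Module.Basis ι K V) (S : Set (ι × V)) : V →ₗ[K] V :=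
  b.constr K fun e => if h : ∃ v, (e, v) ∈ S then h.choose else b e

/-- The parallel rewriting relation of `S`: all basis elements in the support are reduced
at once. -/
def ParStep (b : Module.Basis ι K V) (S : Set (ι × V)) (u u' : V) : Prop :=
  u' = parMap b S u

/-- `u'` is the `S`-normal form of `u`: `u` rewrites into `u'` by parallel steps of `S`, and
`r_S` acts trivially on `u'`. Such a `u'` is unique, since `u` rewrites only into the
`r_S^k u`. -/
def IsNormalFormOf (b : Module.Basis ι K V) (S : Set (ι × V)) (u u' : V) : Prop :=
  Relation.ReflTransGen (ParStep b S) u u' ∧ parMap b S u' = u'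

end Rewriting

/-! ## Rational functions and their partial derivatives -/

/-- The field `ℚ(X)` of rational functions in `x_1, …, x_n`. -/
def RatFun (n : ℕ) : Type := FractionRing (MvPolynomial (Fin n) ℚ)

instance (n : ℕ) : Field (RatFun n) := inferInstanceAs (Field (FractionRing _))

instance (n : ℕ) : Algebra (MvPolynomial (Fin n) ℚ) (RatFun n) :=
  inferInstanceAs (Algebra (MvPolynomial (Fin n) ℚ) (FractionRing (MvPolynomial (Fin n) ℚ)))

instance (n : ℕ) : IsFractionRing (MvPolynomial (Fin n) ℚ) (RatFun n) :=
  inferInstanceAs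
    (IsFractionRing (MvPolynomial (Fin n) ℚ) (FractionRing (MvPolynomial (Fin n) ℚ)))

/-- Polynomials as rational functions. -/
abbrev ofPoly {n : ℕ} : MvPolynomial (Fin n) ℚ →+* RatFun n :=
  algebraMap (MvPolynomial (Fin n) ℚ) (RatFun n)

instance (n : ℕ) : CharZero (RatFun n) :=
  charZero_of_injective_algebraMap (IsFractionRing.injective (MvPolynomial (Fin n) ℚ) (RatFun n))

/-- The quotient rule, on the numerator and the denominator of a rational function. -/
def ratDerivFun {n : ℕ} (i : Fin n) (f : RatFun n) : RatFun n :=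
  (ofPoly (MvPolynomial.pderiv i (IsFractionRing.num (MvPolynomial (Fin n) ℚ) f)) *
      ofPoly (IsFractionRing.den (MvPolynomial (Fin n) ℚ) f : MvPolynomial (Fin n) ℚ) -
    ofPoly (IsFractionRing.num (MvPolynomial (Fin n) ℚ) f) *
      ofPoly (MvPolynomial.pderiv i
        (IsFractionRing.den (MvPolynomial (Fin n) ℚ) f : MvPolynomial (Fin n) ℚ))) /
    ofPoly (IsFractionRing.den (MvPolynomial (Fin n) ℚ) f : MvPolynomial (Fin n) ℚ) ^ 2

theorem ofPoly_ne_zero {n : ℕ} {p : MvPolynomial (Fin n) ℚ} (hp : p ≠ 0) : ofPoly p ≠ 0 :=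
  (map_ne_zero_iff _ (IsFractionRing.injective _ _)).2 hp

/-- The quotient rule holds for every way to write a rational function as a fraction. -/
theorem ratDerivFun_div {n : ℕ} (i : Fin n) (p q : MvPolynomial (Fin n) ℚ) (hq : q ≠ 0) :
    ratDerivFun i (ofPoly p / ofPoly q) =
      (ofPoly (MvPolynomial.pderiv i p) * ofPoly q - ofPoly p * ofPoly (MvPolynomial.pderiv i q)) /
        ofPoly q ^ 2 := by
  unfold ratDerivFun
  set f := ofPoly p / ofPoly q with hf
  set a := IsFractionRing.num (MvPolynomial (Fin n) ℚ) f
  set d : MvPolynomial (Fin n) ℚ := ↑(IsFractionRing.den (MvPolynomial (Fin n) ℚ) f) with hd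
  have hd0 : d ≠ 0 := nonZeroDivisors.coe_ne_zero _
  have h1 : ofPoly a / ofPoly d = f := by
    have := IsFractionRing.mk'_num_den (MvPolynomial (Fin n) ℚ) f
    rwa [IsFractionRing.mk'_eq_div] at this
  have hd' := ofPoly_ne_zero hd0
  have hq' := ofPoly_ne_zero hq
  have h2 : a * q = p * d := by
    apply IsFractionRing.injective (MvPolynomial (Fin n) ℚ) (RatFun n)
    rw [map_mul, map_mul]
    rw [hf, div_eq_div_iff hd' hq'] at h1
    exact h1
  have h3 := congrArg (MvPolynomial.pderiv i) h2
  simp only [Derivation.leibniz, smul_eq_mul] at h3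
  have h2' := congrArg (ofPoly (n := n)) h2
  have h3' := congrArg (ofPoly (n := n)) h3
  simp only [map_add, map_mul] at h2' h3'
  rw [div_eq_div_iff (pow_ne_zero 2 hd') (pow_ne_zero 2 hq')]
  linear_combination (ofPoly q * ofPoly d) * h3' -
    (ofPoly (MvPolynomial.pderiv i q) * ofPoly d +
      ofPoly (MvPolynomial.pderiv i d) * ofPoly q) * h2'

theorem exists_fraction {n : ℕ} (f : RatFun n) :
    ∃ p q : MvPolynomial (Fin n) ℚ, q ≠ 0 ∧ f = ofPoly p / ofPoly q := by
  obtain ⟨p, q, hq, h⟩ := IsFractionRing.div_surjective (A := MvPolynomial (Fin n) ℚ) f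
  exact ⟨p, q, nonZeroDivisors.ne_zero hq, h.symm⟩

/-- The partial derivative `d/dx_i` of rational functions, a `ℚ`-linear derivation of `ℚ(X)`. -/
def ratDeriv {n : ℕ} (i : Fin n) : Derivation ℚ (RatFun n) (RatFun n) :=
  Derivation.mk'
    { toFun := ratDerivFun i
      map_add' := by
        intro f g
        obtain ⟨p, q, hq, rfl⟩ := exists_fraction f
        obtain ⟨r, s, hs, rfl⟩ := exists_fraction g
        have hq' := ofPoly_ne_zero hq
        have hs' := ofPoly_ne_zero hs
        have h : ofPoly p / ofPoly q + ofPoly r / ofPoly s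
            = ofPoly (p * s + q * r) / ofPoly (q * s) := by
          rw [div_add_div _ _ hq' hs']; simp only [map_add, map_mul]
        rw [h, ratDerivFun_div i _ _ (mul_ne_zero hq hs), ratDerivFun_div i _ _ hq,
          ratDerivFun_div i _ _ hs]
        simp only [map_add, map_mul, Derivation.leibniz, smul_eq_mul]
        field_simp
        ring
      map_smul' := by
        intro c f
        obtain ⟨p, q, hq, rfl⟩ := exists_fraction f
        have hq' := ofPoly_ne_zero hq
        have h' : ∀ g : RatFun n, c • g = ofPoly (MvPolynomial.C c) * g := by
          intro g
          rw [Algebra.smul_def]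
          congr 1
          exact RingHom.congr_fun
            (Subsingleton.elim (algebraMap ℚ (RatFun n)) (ofPoly.comp MvPolynomial.C)) c
        have h : c • (ofPoly p / ofPoly q) = ofPoly (MvPolynomial.C c * p) / ofPoly q := by
          rw [h', map_mul, mul_div_assoc]
        rw [h, ratDerivFun_div i _ _ hq, ratDerivFun_div i _ _ hq]
        simp only [RingHom.id_apply, h', map_mul, Derivation.leibniz, smul_eq_mul,
          MvPolynomial.pderiv_C, mul_zero, add_zero]
        field_simp }
    (by
      intro f g
      obtain ⟨p, q, hq, rfl⟩ := exists_fraction f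
      obtain ⟨r, s, hs, rfl⟩ := exists_fraction g
      have hq' := ofPoly_ne_zero hq
      have hs' := ofPoly_ne_zero hs
      have h : ofPoly p / ofPoly q * (ofPoly r / ofPoly s)
          = ofPoly (p * r) / ofPoly (q * s) := by
        rw [div_mul_div_comm, map_mul, map_mul]
      change ratDerivFun i _ = _ • ratDerivFun i _ + _ • ratDerivFun i _
      rw [h, ratDerivFun_div i _ _ (mul_ne_zero hq hs), ratDerivFun_div i _ _ hq,
        ratDerivFun_div i _ _ hs]
      simp only [map_mul, map_add, Derivation.leibniz, smul_eq_mul]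
      field_simp
      ring)

/-- On polynomials, `d/dx_i` is the usual partial derivative. -/
theorem ratDeriv_ofPoly {n : ℕ} (i : Fin n) (p : MvPolynomial (Fin n) ℚ) :
    ratDeriv i (ofPoly p) = ofPoly (MvPolynomial.pderiv i p) := by
  have h := ratDerivFun_div i p 1 one_ne_zero
  simp only [map_one, div_one, mul_one, one_pow, Derivation.map_one_eq_zero, map_zero, mul_zero,
    sub_zero] at h
  exact h

theorem ratDeriv_comm {n : ℕ} (i j : Fin n) (f : RatFun n) :
    ratDeriv i (ratDeriv j f) = ratDeriv j (ratDeriv i f) := by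
  have key : ∀ p : MvPolynomial (Fin n) ℚ, ⁅ratDeriv i, ratDeriv j⁆ (ofPoly p) = 0 := by
    have h0 : ⁅MvPolynomial.pderiv (R := ℚ) i, MvPolynomial.pderiv (R := ℚ) j⁆ = 0 := by
      apply MvPolynomial.derivation_ext
      intro k
      rw [Derivation.commutator_apply]
      simp only [MvPolynomial.pderiv_X, Pi.single_apply]
      split_ifs <;> simp
    intro p
    have h1 := congrArg (fun D => ofPoly (D p)) h0
    simp only [Derivation.commutator_apply, Derivation.zero_apply, map_zero, map_sub] at h1
    rw [Derivation.commutator_apply]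
    simp only [ratDeriv_ofPoly]
    exact h1
  obtain ⟨p, q, hq, rfl⟩ := exists_fraction f
  have h2 : ⁅ratDeriv i, ratDeriv j⁆ (ofPoly p / ofPoly q) = 0 := by
    rw [Derivation.leibniz_div, key, key]; simp
  rw [Derivation.commutator_apply] at h2
  exact sub_eq_zero.1 h2

/-! ## The rational Weyl algebra -/

/-- The rational Weyl algebra `ℚ(X)[∂_1, …, ∂_n]`: an operator is a finitely supported family of
coefficients in `ℚ(X)`, indexed by the exponents `α ∈ ℕⁿ` of the monomials `∂^α`, with the
coefficients written on the left. The multiplication is defined below. -/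
def Weyl (n : ℕ) : Type := (Fin n →₀ ℕ) →₀ RatFun n

namespace Weyl

variable {n : ℕ}

instance : AddCommGroup (Weyl n) := inferInstanceAs (AddCommGroup ((Fin n →₀ ℕ) →₀ RatFun n))

instance : Module (RatFun n) (Weyl n) :=
  inferInstanceAs (Module (RatFun n) ((Fin n →₀ ℕ) →₀ RatFun n))

instance : Module ℚ (Weyl n) :=
  inferInstanceAs (Module ℚ ((Fin n →₀ ℕ) →₀ RatFun n))

instance : IsScalarTower ℚ (RatFun n) (Weyl n) :=
  inferInstanceAs (IsScalarTower ℚ (RatFun n) ((Fin n →₀ ℕ) →₀ RatFun n))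

instance : SMulCommClass ℚ (RatFun n) (Weyl n) :=
  inferInstanceAs (SMulCommClass ℚ (RatFun n) ((Fin n →₀ ℕ) →₀ RatFun n))

/-- The basis of monomials `∂^α`, indexed by `α ∈ ℕⁿ`. -/
def monBasis (n : ℕ) : Module.Basis (Fin n →₀ ℕ) (RatFun n) (Weyl n) :=
  Module.Basis.ofRepr (LinearEquiv.refl (RatFun n) ((Fin n →₀ ℕ) →₀ RatFun n))

/-- The monomial `∂^α`. -/
def mon (α : Fin n →₀ ℕ) : Weyl n := monBasis n α

theorem ext_hom {M : Type*} [AddCommGroup M] {φ ψ : Weyl n →+ M}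
    (h : ∀ (f : RatFun n) (α : Fin n →₀ ℕ), φ (f • mon α) = ψ (f • mon α)) (w : Weyl n) :
    φ w = ψ w := by
  have hw : w ∈ Submodule.span (RatFun n) (Set.range (monBasis n)) := by
    rw [(monBasis n).span_eq]; trivial
  induction hw using Submodule.closure_induction with
  | zero => simp
  | add x y _ _ hx hy => rw [map_add, map_add, hx, hy]
  | smul_mem r x hx => obtain ⟨α, rfl⟩ := hx; exact h r α

/-- Left multiplication by `∂_i`:
`∂_i · (∑ f_α ∂^α) = ∑ f_α ∂^(α + e_i) + ∑ (d f_α / dx_i) ∂^α`. -/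
def dLeft (i : Fin n) : Module.End ℚ (Weyl n) :=
  Finsupp.lmapDomain (RatFun n) ℚ (fun α : Fin n →₀ ℕ => α + Finsupp.single i 1) +
    Finsupp.mapRange.linearMap (ratDeriv i).toLinearMap

theorem smul_mon (f : RatFun n) (α : Fin n →₀ ℕ) : f • mon α = Finsupp.single α f := by
  change f • Finsupp.single α (1 : RatFun n) = _
  rw [Finsupp.smul_single, smul_eq_mul, mul_one]

theorem dLeft_smul_mon (i : Fin n) (f : RatFun n) (α : Fin n →₀ ℕ) :
    dLeft i (f • mon α) = f • mon (α + Finsupp.single i 1) + ratDeriv i f • mon α := by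
  simp only [smul_mon]
  change Finsupp.mapDomain (fun α : Fin n →₀ ℕ => α + Finsupp.single i 1) (Finsupp.single α f) +
    Finsupp.mapRange (ratDeriv i) (map_zero _) (Finsupp.single α f) = _
  rw [Finsupp.mapDomain_single, Finsupp.mapRange_single]
  rfl

theorem dLeft_smul (i : Fin n) (f : RatFun n) (w : Weyl n) :
    dLeft i (f • w) = f • dLeft i w + ratDeriv i f • w := by
  refine ext_hom (φ := (dLeft i).toAddMonoidHom.comp (DistribSMul.toAddMonoidHom (Weyl n) f))
    (ψ := (DistribSMul.toAddMonoidHom (Weyl n) f).comp (dLeft i).toAddMonoidHom +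
      DistribSMul.toAddMonoidHom (Weyl n) (ratDeriv i f)) ?_ w
  intro g α
  change dLeft i (f • g • mon α) = f • dLeft i (g • mon α) + ratDeriv i f • g • mon α
  rw [smul_smul, dLeft_smul_mon, dLeft_smul_mon, Derivation.leibniz]
  simp only [smul_eq_mul]
  module

theorem dLeft_comm (i j : Fin n) : Commute (dLeft i) (dLeft j) := by
  apply LinearMap.ext
  intro w
  refine ext_hom (φ := (dLeft i * dLeft j).toAddMonoidHom)
    (ψ := (dLeft j * dLeft i).toAddMonoidHom) ?_ w
  intro f α
  change dLeft i (dLeft j (f • mon α)) = dLeft j (dLeft i (f • mon α))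
  simp only [dLeft_smul_mon, map_add]
  rw [ratDeriv_comm i j, add_right_comm α]
  abel

theorem dLeft_pairwise (α : Fin n →₀ ℕ) :
    ((Finset.univ : Finset (Fin n)) : Set (Fin n)).Pairwise
      (Function.onFun Commute fun i => dLeft i ^ α i) :=
  fun i _ j _ _ => (dLeft_comm i j).pow_pow (α i) (α j)

/-- Left multiplication by the monomial `∂^α = ∂_1^(α_1) ⋯ ∂_n^(α_n)`. -/
def monLeft (α : Fin n →₀ ℕ) : Module.End ℚ (Weyl n) :=
  Finset.univ.noncommProd (fun i => dLeft i ^ α i) (dLeft_pairwise α)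

theorem monLeft_zero : monLeft (0 : Fin n →₀ ℕ) = 1 := by
  unfold monLeft
  rw [Finset.noncommProd_eq_pow_card _ _ _ 1]
  · simp
  · intro i _; simp

theorem monLeft_add (α β : Fin n →₀ ℕ) : monLeft (α + β) = monLeft α * monLeft β := by
  unfold monLeft
  rw [← Finset.noncommProd_mul_distrib]
  · apply Finset.noncommProd_congr rfl
    intro i _
    simp [pow_add]
  · intro i _ j _ _
    exact (dLeft_comm i j).pow_pow _ _

theorem monLeft_single (i : Fin n) : monLeft (Finsupp.single i 1) = dLeft i := by
  classical
  unfold monLeft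
  rw [← Finset.mul_noncommProd_erase _ (Finset.mem_univ i) _ (dLeft_pairwise _)
    ((dLeft_pairwise _).mono fun _ _ => Finset.mem_coe.2 (Finset.mem_univ _)),
    Finset.noncommProd_eq_pow_card _ _ _ 1]
  · simp
  · intro j hj
    rw [Finsupp.single_eq_of_ne (Finset.ne_of_mem_erase hj), pow_zero]

theorem exponent_induction {P : (Fin n →₀ ℕ) → Prop} (zero : P 0)
    (succ : ∀ α i, P α → P (α + Finsupp.single i 1)) (α : Fin n →₀ ℕ) : P α := by
  have h : ∀ β α : Fin n →₀ ℕ, P α → P (α + β) := by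
    intro β
    induction β using Finsupp.induction_linear with
    | zero => intro α h; simpa using h
    | add f g hf hg => intro α h; rw [← add_assoc]; exact hg _ (hf _ h)
    | single i k =>
      induction k with
      | zero => intro α h; simpa using h
      | succ k ih =>
        intro α h
        rw [Finsupp.single_add, ← add_assoc]
        exact succ _ _ (ih _ h)
  simpa using h α 0 zero

theorem monLeft_mon (α β : Fin n →₀ ℕ) : monLeft α (mon β) = mon (α + β) := by
  induction α using exponent_induction generalizing β with
  | zero => rw [monLeft_zero, zero_add]; rfl
  | succ α i ih =>
    rw [monLeft_add, monLeft_single]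
    have h := dLeft_smul_mon i 1 β
    rw [one_smul, one_smul, Derivation.map_one_eq_zero, zero_smul, add_zero] at h
    change monLeft α (dLeft i (mon β)) = _
    rw [h, ih, add_assoc, add_comm β]

/-- The operator of left multiplication by `∑ f_α ∂^α`, that is
`w ↦ ∑ f_α • (∂^α · w)`. -/
def leftMul (u : Weyl n) : Module.End ℚ (Weyl n) :=
  Finsupp.sum u fun α f => f • monLeft α

theorem leftMul_add (u v : Weyl n) : leftMul (u + v) = leftMul u + leftMul v :=
  Finsupp.sum_add_index' (fun _ => zero_smul _ _) (fun _ _ _ => add_smul _ _ _)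

/-- `leftMul` as an additive map. -/
def leftMulHom : Weyl n →+ Module.End ℚ (Weyl n) := AddMonoidHom.mk' leftMul leftMul_add

theorem leftMul_smul_mon (f : RatFun n) (α : Fin n →₀ ℕ) :
    leftMul (f • mon α) = f • monLeft α := by
  rw [smul_mon]
  exact Finsupp.sum_single_index (zero_smul _ _)

theorem leftMul_smul (f : RatFun n) (w : Weyl n) : leftMul (f • w) = f • leftMul w := by
  refine ext_hom (φ := leftMulHom.comp (DistribSMul.toAddMonoidHom (Weyl n) f))
    (ψ := (DistribSMul.toAddMonoidHom (Module.End ℚ (Weyl n)) f).comp leftMulHom) ?_ w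
  intro g α
  change leftMul (f • g • mon α) = f • leftMul (g • mon α)
  rw [smul_smul, leftMul_smul_mon, leftMul_smul_mon, smul_smul]

theorem leftMul_dLeft (i : Fin n) (w : Weyl n) : leftMul (dLeft i w) = dLeft i * leftMul w := by
  refine ext_hom (φ := leftMulHom.comp (dLeft i).toAddMonoidHom)
    (ψ := (AddMonoidHom.mulLeft (dLeft i)).comp leftMulHom) ?_ w
  intro f α
  change leftMul (dLeft i (f • mon α)) = dLeft i * leftMul (f • mon α)
  rw [dLeft_smul_mon, leftMul_add, leftMul_smul_mon, leftMul_smul_mon, leftMul_smul_mon,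
    add_comm α, monLeft_add, monLeft_single]
  apply LinearMap.ext
  intro v
  exact (dLeft_smul i f (monLeft α v)).symm

theorem leftMul_monLeft (α : Fin n →₀ ℕ) (w : Weyl n) :
    leftMul (monLeft α w) = monLeft α * leftMul w := by
  induction α using exponent_induction generalizing w with
  | zero => rw [monLeft_zero, one_mul]; rfl
  | succ α i ih =>
    rw [monLeft_add, monLeft_single]
    change leftMul (monLeft α (dLeft i w)) = _
    rw [ih, leftMul_dLeft, mul_assoc]

theorem leftMul_leftMul (u v : Weyl n) : leftMul (leftMul u v) = leftMul u * leftMul v := by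
  refine ext_hom (φ := leftMulHom.comp ((LinearMap.applyₗ v).toAddMonoidHom.comp leftMulHom))
    (ψ := (AddMonoidHom.mulRight (leftMul v)).comp leftMulHom) ?_ u
  intro f α
  change leftMul (leftMul (f • mon α) v) = leftMul (f • mon α) * leftMul v
  rw [leftMul_smul_mon]
  change leftMul (f • monLeft α v) = _
  rw [leftMul_smul, leftMul_monLeft, smul_mul_assoc]

theorem leftMul_mon_zero (u : Weyl n) : leftMul u (mon 0) = u := by
  refine ext_hom (φ := (LinearMap.applyₗ (mon 0)).toAddMonoidHom.comp leftMulHom)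
    (ψ := AddMonoidHom.id (Weyl n)) ?_ u
  intro f α
  change leftMul (f • mon α) (mon 0) = f • mon α
  rw [leftMul_smul_mon, LinearMap.smul_apply, monLeft_mon, add_zero]

theorem leftMul_mon (α : Fin n →₀ ℕ) : leftMul (mon α) = monLeft α := by
  rw [← one_smul (RatFun n) (mon α), leftMul_smul_mon, one_smul]

/-- The ring structure of the rational Weyl algebra. -/
instance : Ring (Weyl n) :=
  { (inferInstance : AddCommGroup (Weyl n)) with
    mul := fun u v => leftMul u v
    one := mon 0
    left_distrib := fun u v w => map_add (leftMul u) v w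
    right_distrib := fun u v w => by
      change leftMul (u + v) w = leftMul u w + leftMul v w
      rw [leftMul_add]; rfl
    zero_mul := fun u => by
      change leftMul 0 u = 0
      exact congrArg (fun T : Module.End ℚ (Weyl n) => T u) (map_zero leftMulHom)
    mul_zero := fun u => map_zero (leftMul u)
    mul_assoc := fun u v w => by
      change leftMul (leftMul u v) w = leftMul u (leftMul v w)
      rw [leftMul_leftMul]; rfl
    one_mul := fun u => by
      change leftMul (mon 0) u = u
      rw [leftMul_mon, monLeft_zero]; rfl
    mul_one := leftMul_mon_zero }

instance : Algebra ℚ (Weyl n) :=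
  Algebra.ofModule
    (fun c u v => by
      change leftMul (c • u) v = c • leftMul u v
      rw [← algebraMap_smul (RatFun n) c u, leftMul_smul, ← algebraMap_smul (RatFun n) c]
      rfl)
    (fun c u v => map_smul (leftMul u) c v)

/-- A rational function as an operator (of order zero). -/
def coeff (f : RatFun n) : Weyl n := f • mon 0

/-- The variable `∂_i`. -/
def partialVar (i : Fin n) : Weyl n := mon (Finsupp.single i 1)

/-- The scalar multiplication of `ℚ(X)` is left multiplication. -/
theorem coeff_mul (f : RatFun n) (w : Weyl n) : coeff f * w = f • w := by
  change leftMul (f • mon 0) w = f • w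
  rw [leftMul_smul_mon, monLeft_zero]; rfl

theorem mon_add (α β : Fin n →₀ ℕ) : mon (α + β) = mon α * mon β := by
  change _ = leftMul (mon α) (mon β)
  rw [leftMul_mon, monLeft_mon]

/-- The commutation law `∂_i ∂_j = ∂_j ∂_i`. -/
theorem partialVar_comm (i j : Fin n) :
    partialVar i * partialVar j = partialVar j * partialVar i := by
  unfold partialVar
  rw [← mon_add, ← mon_add, add_comm]

/-- The commutation law `∂_i f = f ∂_i + d f / dx_i`. -/
theorem partialVar_mul_coeff (i : Fin n) (f : RatFun n) :
    partialVar i * coeff f = coeff f * partialVar i + coeff (ratDeriv i f) := by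
  rw [coeff_mul]
  change leftMul (mon _) (f • mon 0) = _
  rw [leftMul_mon, monLeft_single, dLeft_smul_mon, zero_add]
  rfl

end Weyl

/-! ## Monic operators and their rewriting rules -/

section Operators

variable {n : ℕ}

/-- The exponent of the leading monomial of `D`: the greatest element of the support of `D` for
the monomial order `m` (and `0` if `D = 0`). -/
def lm (m : MonomialOrder (Fin n)) (D : Weyl n) : Fin n →₀ ℕ :=
  m.toSyn.symm (((Weyl.monBasis n).repr D).support.sup m.toSyn)

/-- `D` is monic: the coefficient of its leading monomial is `1`. -/
def IsMonic (m : MonomialOrder (Fin n)) (D : Weyl n) : Prop :=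
  (Weyl.monBasis n).repr D (lm m D) = 1

/-- `r(D) = lm(D) - D`. -/
def tail (m : MonomialOrder (Fin n)) (D : Weyl n) : Weyl n := Weyl.mon (lm m D) - D

/-- The rules `∂^α lm(D) → ∂^α r(D)`, for `D ∈ Θ` and all monomials `∂^α`. -/
def rules (m : MonomialOrder (Fin n)) (Θ : Finset (Weyl n)) : Set ((Fin n →₀ ℕ) × Weyl n) :=
  {ρ | ∃ D ∈ Θ, ∃ α : Fin n →₀ ℕ, ρ = (α + lm m D, Weyl.mon α * tail m D)}

/-- The rewriting relation on the rational Weyl algebra induced by `Θ`. -/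
def RewritesTo (m : MonomialOrder (Fin n)) (Θ : Finset (Weyl n)) : Weyl n → Weyl n → Prop :=
  Step (Weyl.monBasis n) (rules m Θ)

end Operators

/-! ## Involutive divisions

A monomial `∂^α` is given by its exponent `α`; products of monomials are sums of exponents, and
`∂^α` divides `∂^β` if and only if `α ≤ β`. -/

/-- An involutive division on the monomials in `∂_1, …, ∂_n`: for every finite set `U` of
monomials a relation `dvd U u m` between elements `u` of `U` and monomials `m`. -/
structure InvolutiveDivision (n : ℕ) where
  /-- `dvd U u m`: `u` is an involutive divisor of `m` with respect to `U`. -/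
  dvd : Finset (Fin n →₀ ℕ) → (Fin n →₀ ℕ) → (Fin n →₀ ℕ) → Prop
  /-- The relation is a relation on `U × Mon`. -/
  mem_of_dvd : ∀ {U u m}, dvd U u m → u ∈ U
  le_of_dvd : ∀ {U u m}, dvd U u m → u ≤ m
  dvd_self : ∀ {U u}, u ∈ U → dvd U u u
  dvd_mul_iff : ∀ {U u}, u ∈ U → ∀ m m', (dvd U u (u + m) ∧ dvd U u (u + m')) ↔
    dvd U u (u + m + m')
  dvd_or_dvd : ∀ {U u u' m}, dvd U u m → dvd U u' m → dvd U u u' ∨ dvd U u' u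
  dvd_trans : ∀ {U u u' m}, dvd U u u' → dvd U u' m → dvd U u m
  dvd_of_subset : ∀ {U V v m}, V ⊆ U → v ∈ V → dvd U v m → dvd V v m

namespace InvolutiveDivision

variable {n : ℕ}

/-- `U` is `L`-autoreduced: each `u ∈ U` has only `u` as an `L`-involutive divisor. -/
def IsAutoreduced (L : InvolutiveDivision n) (U : Finset (Fin n →₀ ℕ)) : Prop :=
  ∀ u ∈ U, ∀ u' ∈ U, L.dvd U u' u → u' = u

end InvolutiveDivision

section Involutive

variable {n : ℕ}

/-- `lm(Θ)`, the set of leading monomials of the elements of `Θ`. -/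
def lmSet (m : MonomialOrder (Fin n)) (Θ : Finset (Weyl n)) : Finset (Fin n →₀ ℕ) :=
  Θ.image (lm m)

/-- `Θ` is left `L`-autoreduced: `lm(Θ)` is `L`-autoreduced. -/
def IsLeftAutoreduced (m : MonomialOrder (Fin n)) (L : InvolutiveDivision n)
    (Θ : Finset (Weyl n)) : Prop :=
  L.IsAutoreduced (lmSet m Θ)

/-- `S_{Θ,L}`: the rules `∂^α lm(D) → ∂^α r(D)`, for `D ∈ Θ` and those monomials `∂^α` such
that `lm(D)` is an `L`-involutive divisor of `∂^α lm(D)` with respect to `lm(Θ)`. -/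
def strategy (m : MonomialOrder (Fin n)) (L : InvolutiveDivision n) (Θ : Finset (Weyl n)) :
    Set ((Fin n →₀ ℕ) × Weyl n) :=
  {ρ | ∃ D ∈ Θ, ∃ α : Fin n →₀ ℕ, L.dvd (lmSet m Θ) (lm m D) (α + lm m D) ∧
    ρ = (α + lm m D, Weyl.mon α * tail m D)}

/-- `Θ` is `L`-involutive: the `S_{Θ,L}`-normal form of `∂^α D` is `0`, for all `D ∈ Θ` and all
monomials `∂^α`. -/
def IsInvolutive (m : MonomialOrder (Fin n)) (L : InvolutiveDivision n)
    (Θ : Finset (Weyl n)) : Prop :=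
  ∀ D ∈ Θ, ∀ α : Fin n →₀ ℕ,
    IsNormalFormOf (Weyl.monBasis n) (strategy m L Θ) (Weyl.mon α * D) 0

end Involutive

end InvRew

end

/-! Write T for `parMap b S`, the map r_S. A rule e → v of R_Θ given by D and ∂^α satisfies e - v =
∂^α D, so involutivity says that some power of T kills e - v. The vectors killed by some power of T
form a subspace, hence this subspace contains w - w' whenever w rewrites into w'
(`exists_pow_sub_eq_zero`). If w rewrites into w_1 and into w_2, then T^N w_1 = T^N w_2 for large N,
and this vector is the common reduct; neither critical pairs nor Newman's lemma enter.

It remains to realize T by individual steps (`reflTransGen_step_sum_add`). The monomials of a vector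
are rewritten in increasing order: right-hand sides contain only monomials below the one being
rewritten, so the coefficients still to be treated stay unchanged. The decrease holds because left
multiplication by ∂^α creates, besides the shifted monomials, only smaller ones
(`mon_mul_mem_below`). -/

namespace InvRew

/-! ### Parallel and sequential rewriting in a vector space -/

section Rewriting

variable {K V ι κ : Type*} [Field K] [AddCommGroup V] [Module K V]

/-- Every basis element is either fixed by `parMap b S` or mapped to the right-hand side of a rule
of `S`. -/
theorem parMap_basis_cases (b : Module.Basis ι K V) (S : Set (ι × V)) (e : ι) :
    parMap b S (b e) = b e ∨ (e, parMap b S (b e)) ∈ S := by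
  classical
  unfold parMap
  rw [Module.Basis.constr_basis]
  split_ifs with h
  · exact Or.inr h.choose_spec
  · exact Or.inl rfl

/-- If the rules of `S ⊆ R` decrease monomials, then a linear combination of basis elements, plus a
remainder with strictly greater support, rewrites by steps of `R` into its image under `parMap b S`,
plus the remainder: the basis elements are rewritten in increasing order. -/
theorem reflTransGen_step_sum_add [LinearOrder κ] (b : Module.Basis ι K V) {S R : Set (ι × V)}
    (hSR : S ⊆ R) {f : ι → κ} (hf : Function.Injective f)
    (hdec : ∀ ρ ∈ S, ∀ e ∈ (b.repr ρ.2).support, f e < f ρ.1) (c : ι → K) (s : Finset ι) :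
    ∀ u : V, (∀ e ∈ s, ∀ e' ∈ (b.repr u).support, f e < f e') →
      Relation.ReflTransGen (Step b R) (∑ e ∈ s, c e • b e + u)
        (∑ e ∈ s, c e • parMap b S (b e) + u) := by
  classical
  induction s using Finset.induction_on_max_value f with
  | empty => intro u _; simpa using Relation.ReflTransGen.refl
  | insert a s ha hmax ih =>
    intro u hu
    rw [Finset.sum_insert ha, Finset.sum_insert ha]
    have hlt : ∀ e ∈ s, f e < f a := fun e he =>
      lt_of_le_of_ne (hmax e he) fun h => ha (hf h ▸ he)
    -- The greatest element `a` must be rewritten last, so its term waits in the remainder while `s`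
    -- is treated; this is why the induction quantifies over `u`.
    have h1 := ih (c a • b a + u) (by
      intro e he e' he'
      rw [map_add, map_smul, b.repr_self] at he'
      rcases Finset.mem_union.1 (Finsupp.support_add he') with h | h
      · have := Finset.mem_singleton.1 (Finsupp.support_single_subset (Finsupp.support_smul h))
        exact this ▸ hlt e he
      · exact hu e (Finset.mem_insert_of_mem he) e' h)
    have h2 : ∑ e ∈ s, c e • b e + (c a • b a + u) = c a • b a + ∑ e ∈ s, c e • b e + u := by abel
    rw [h2] at h1
    refine h1.trans ?_
    by_cases hc : c a = 0
    -- A step needs a nonzero coefficient; here there is nothing to rewrite.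
    · simpa [hc] using Relation.ReflTransGen.refl
    rcases parMap_basis_cases b S a with h | h
    · rw [h, add_left_comm, add_assoc]
    refine Relation.ReflTransGen.single
      ⟨_, hSR h, c a, hc, ∑ e ∈ s, c e • parMap b S (b e) + u, ?_, by abel, by dsimp only; abel⟩
    -- The rest must not contain `a`: an `e` in `s` fixed by the map differs from `a`, a rewritten
    -- one yields only elements below `e`, hence below `a`, and the support of `u` lies above `a`.
    intro hmem
    rw [map_add] at hmem
    rcases Finset.mem_union.1 (Finsupp.support_add hmem) with hm | hm
    · rw [map_sum] at hm
      obtain ⟨e, he, hm⟩ := Finset.mem_biUnion.1 (Finsupp.support_finsetSum hm)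
      rw [map_smul] at hm
      replace hm := Finsupp.support_smul hm
      rcases parMap_basis_cases b S e with h' | h'
      · rw [h', b.repr_self] at hm
        have hae : a = e := Finset.mem_singleton.1 (Finsupp.support_single_subset hm)
        exact ha (hae ▸ he)
      · exact lt_asymm (hlt e he) (hdec _ h' _ hm)
    · exact lt_irrefl _ (hu a (Finset.mem_insert_self a s) a hm)

/-- A parallel step of `S` is a sequence of steps of `R ⊇ S`, if the rules of `S` decrease
monomials. -/
theorem reflTransGen_step_parMap [LinearOrder κ] (b : Module.Basis ι K V) {S R : Set (ι × V)}
    (hSR : S ⊆ R) {f : ι → κ} (hf : Function.Injective f)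
    (hdec : ∀ ρ ∈ S, ∀ e ∈ (b.repr ρ.2).support, f e < f ρ.1) (w : V) :
    Relation.ReflTransGen (Step b R) w (parMap b S w) := by
  have hw : w = ∑ e ∈ (b.repr w).support, b.repr w e • b e := by
    conv_lhs => rw [← b.linearCombination_repr w, Finsupp.linearCombination_apply]
    rfl
  have h := reflTransGen_step_sum_add b hSR hf hdec (b.repr w) (b.repr w).support 0 (by simp)
  have hw' := congrArg (parMap b S) hw
  simp only [map_sum, map_smul] at hw'
  rwa [add_zero, add_zero, ← hw, ← hw'] at h

theorem reflTransGen_step_parMap_pow [LinearOrder κ] (b : Module.Basis ι K V)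
    {S R : Set (ι × V)} (hSR : S ⊆ R) {f : ι → κ} (hf : Function.Injective f)
    (hdec : ∀ ρ ∈ S, ∀ e ∈ (b.repr ρ.2).support, f e < f ρ.1) (k : ℕ) (w : V) :
    Relation.ReflTransGen (Step b R) w ((parMap b S ^ k) w) := by
  induction k with
  | zero => exact Relation.ReflTransGen.refl
  | succ k ih =>
    rw [pow_succ']
    exact ih.trans (reflTransGen_step_parMap b hSR hf hdec _)

/-- Parallel steps are deterministic, so a chain of them is an iteration of the map. -/
theorem IsNormalFormOf.exists_pow_eq {b : Module.Basis ι K V} {S : Set (ι × V)} {u u' : V}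
    (h : IsNormalFormOf b S u u') : ∃ k : ℕ, (parMap b S ^ k) u = u' := by
  obtain ⟨h, -⟩ := h
  induction h with
  | refl => exact ⟨0, rfl⟩
  | tail _ hs ih =>
    obtain ⟨k, hk⟩ := ih
    exact ⟨k + 1, by rw [pow_succ', Module.End.mul_apply, hk]; exact hs.symm⟩

/-- The vectors annihilated by some power of an endomorphism contain the differences along any
rewriting sequence, if they contain `e - v` for every rule `e → v`. -/
theorem exists_pow_sub_eq_zero (b : Module.Basis ι K V) {R : Set (ι × V)} (T : Module.End K V)
    (hT : ∀ ρ ∈ R, ∃ k : ℕ, (T ^ k) (b ρ.1 - ρ.2) = 0) {w w' : V}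
    (h : Relation.ReflTransGen (Step b R) w w') : ∃ k : ℕ, (T ^ k) (w - w') = 0 := by
  -- The generalized eigenspace for 0 is the union of the kernels of the powers of `T`. As a
  -- submodule it absorbs sums and scalars, with no bookkeeping of exponents along the sequence.
  have key : w - w' ∈ T.maxGenEigenspace 0 := by
    induction h with
    | refl => simp
    | @tail y z _ hs ih =>
      obtain ⟨ρ, hρ, c, -, u, -, rfl, rfl⟩ := hs
      have h1 : b ρ.1 - ρ.2 ∈ T.maxGenEigenspace 0 := by
        simpa [Module.End.mem_maxGenEigenspace] using hT ρ hρ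
      have h2 := add_mem ih (Submodule.smul_mem _ c h1)
      -- The context `u` cancels: a step changes the vector by a multiple of e - v.
      convert h2 using 1
      rw [smul_sub]; abel
  simpa [Module.End.mem_maxGenEigenspace] using key

/-- If a power of `parMap b S` annihilates `e - v` for every rule `e → v` of `R ⊇ S`, and the rules
of `S` decrease monomials, then rewriting by `R` is confluent. -/
theorem confluent_step_of_parMap_pow [LinearOrder κ] (b : Module.Basis ι K V)
    {S R : Set (ι × V)} (hSR : S ⊆ R) {f : ι → κ} (hf : Function.Injective f)
    (hdec : ∀ ρ ∈ S, ∀ e ∈ (b.repr ρ.2).support, f e < f ρ.1)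
    (hR : ∀ ρ ∈ R, ∃ k : ℕ, (parMap b S ^ k) (b ρ.1 - ρ.2) = 0) : Confluent (Step b R) := by
  intro x y z hy hz
  obtain ⟨k, hk⟩ := exists_pow_sub_eq_zero b (parMap b S) hR hy
  obtain ⟨l, hl⟩ := exists_pow_sub_eq_zero b (parMap b S) hR hz
  -- With exponent l + k, the factor T^k can be applied first on the side of `y` and T^l first on
  -- the side of `z`.
  have h : (parMap b S ^ (l + k)) y = (parMap b S ^ (l + k)) z := by
    rw [map_sub, sub_eq_zero] at hk hl
    calc (parMap b S ^ (l + k)) y = (parMap b S ^ (l + k)) x := by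
          rw [pow_add, Module.End.mul_apply, Module.End.mul_apply, hk]
      _ = (parMap b S ^ (l + k)) z := by
          rw [add_comm, pow_add, Module.End.mul_apply, Module.End.mul_apply, hl]
  refine ⟨_, reflTransGen_step_parMap_pow b hSR hf hdec (l + k) y, ?_⟩
  rw [h]
  exact reflTransGen_step_parMap_pow b hSR hf hdec (l + k) z

end Rewriting

/-! ### Decrease of monomials in the rational Weyl algebra -/

section Operators

variable {n : ℕ} (m : MonomialOrder (Fin n))

/-- The operators all of whose monomials are smaller than `∂^α`. -/
noncomputable def below (α : Fin n →₀ ℕ) : Submodule (RatFun n) (Weyl n) :=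
  Submodule.span (RatFun n) (Weyl.monBasis n '' {β | m.toSyn β < m.toSyn α})

theorem mem_below {α : Fin n →₀ ℕ} {w : Weyl n} :
    w ∈ below m α ↔ ∀ β ∈ ((Weyl.monBasis n).repr w).support, m.toSyn β < m.toSyn α :=
  (Weyl.monBasis n).mem_span_image

theorem mon_mem_below {α β : Fin n →₀ ℕ} (h : m.toSyn β < m.toSyn α) :
    Weyl.mon β ∈ below m α :=
  Submodule.subset_span ⟨β, h, rfl⟩

/-- On f ∂^β, left multiplication by ∂_i gives a term at ∂^β ∂_i, bounded by compatibility of the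
order with products, and a derivative term at ∂^β itself, which is no greater. -/
theorem dLeft_mem_below (i : Fin n) {α : Fin n →₀ ℕ} {w : Weyl n} (hw : w ∈ below m α) :
    Weyl.dLeft i w ∈ below m (α + Finsupp.single i 1) := by
  unfold below at hw
  induction hw using Submodule.closure_induction with
  | zero => rw [map_zero]; exact zero_mem _
  | add x y _ _ hx hy => rw [map_add]; exact add_mem hx hy
  | smul_mem r x hx =>
    obtain ⟨β, hβ, rfl⟩ := hx
    have h : m.toSyn (β + Finsupp.single i 1) < m.toSyn (α + Finsupp.single i 1) := by
      rw [map_add, map_add]; exact add_lt_add_left hβ _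
    have h' : m.toSyn β ≤ m.toSyn (β + Finsupp.single i 1) := m.toSyn_monotone le_self_add
    change Weyl.dLeft i (r • Weyl.mon β) ∈ _
    rw [Weyl.dLeft_smul_mon]
    exact add_mem (Submodule.smul_mem _ _ (mon_mem_below m h))
      (Submodule.smul_mem _ _ (mon_mem_below m (h'.trans_lt h)))

theorem mon_mul_mem_below (α : Fin n →₀ ℕ) {β : Fin n →₀ ℕ} {w : Weyl n}
    (hw : w ∈ below m β) : Weyl.mon α * w ∈ below m (α + β) := by
  change Weyl.leftMul (Weyl.mon α) w ∈ _
  rw [Weyl.leftMul_mon]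
  induction α using Weyl.exponent_induction generalizing β w with
  | zero => rw [Weyl.monLeft_zero, zero_add]; exact hw
  | succ α i ih =>
    rw [Weyl.monLeft_add, Weyl.monLeft_single, add_assoc, add_comm (Finsupp.single i 1)]
    -- ∂_i acts before ∂^α, so the induction hypothesis is used for ∂_i w and the shifted bound.
    exact ih (dLeft_mem_below m i hw)

theorem tail_mem_below {D : Weyl n} (hD : IsMonic m D) : tail m D ∈ below m (lm m D) := by
  rw [mem_below]
  intro β hβ
  have hrepr : (Weyl.monBasis n).repr (tail m D) =
      Finsupp.single (lm m D) 1 - (Weyl.monBasis n).repr D := by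
    rw [tail, map_sub, Weyl.mon, Module.Basis.repr_self]
  rw [hrepr, Finsupp.mem_support_iff, Finsupp.sub_apply] at hβ
  -- Monicity makes the leading terms cancel in lm(D) - D.
  have hne : β ≠ lm m D := by
    rintro rfl
    rw [Finsupp.single_eq_same, hD, sub_self] at hβ
    exact hβ rfl
  rw [Finsupp.single_eq_of_ne hne, zero_sub, neg_ne_zero] at hβ
  refine lt_of_le_of_ne ?_ fun h => hne (m.toSyn.injective h)
  rw [lm, AddEquiv.apply_symm_apply]
  exact Finset.le_sup (f := m.toSyn) (Finsupp.mem_support_iff.2 hβ)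

end Operators

end InvRew

theorem mainTheorem4 (n : ℕ) (Θ : Finset (InvRew.Weyl n)) (m : MonomialOrder (Fin n))
    (hmonic : ∀ D ∈ Θ, InvRew.IsMonic m D) (L : InvRew.InvolutiveDivision n)
    (hlm : ∀ D ∈ Θ, ∀ D' ∈ Θ, InvRew.lm m D = InvRew.lm m D' → D = D')
    (hauto : InvRew.IsLeftAutoreduced m L Θ) (hinv : InvRew.IsInvolutive m L Θ) :
    InvRew.Confluent (InvRew.RewritesTo m Θ) := by
  refine InvRew.confluent_step_of_parMap_pow (InvRew.Weyl.monBasis n)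
    (S := InvRew.strategy m L Θ) ?_ m.toSyn.injective ?_ ?_
  · rintro ρ ⟨D, hD, α, -, rfl⟩
    exact ⟨D, hD, α, rfl⟩
  · rintro ρ ⟨D, hD, α, -, rfl⟩
    exact (InvRew.mem_below m).1
      (InvRew.mon_mul_mem_below m α (InvRew.tail_mem_below m (hmonic D hD)))
  · rintro ρ ⟨D, hD, α, rfl⟩
    -- Since r(D) = lm(D) - D, the difference of the two sides of a rule is ∂^α D, the element whose
    -- normal form is 0 by involutivity.
    have h : InvRew.Weyl.monBasis n (α + InvRew.lm m D) -
        InvRew.Weyl.mon α * InvRew.tail m D = InvRew.Weyl.mon α * D := by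
      change InvRew.Weyl.mon (α + InvRew.lm m D) - _ = _
      rw [InvRew.tail, mul_sub, InvRew.Weyl.mon_add, sub_sub_cancel]
    dsimp only
    rw [h]
    exact (hinv D hD α).exists_pow_eq
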